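/- Heyting algebras are considered in the signature $\{\land,\lor,\to,\neg\}$, formulas are propositional formulas in this signature over countably many variables, and $\mathcal H\models A$ means that $A$ takes the value $1$ under every valuation in $\mathcal H$. A variety is a class of Heyting algebras axiomatized by a set of formulas. The opremum of an algebra is the greatest of its elements distinct from $1$. A pair $\langle A(p_1,\dots,p_n),\nu\rangle$ is a presentation of an algebra $\mathcal H$ over a variety $\mathcal V$ if the elements $\nu(p_1),\dots,\nu(p_n)$ generate $\mathcal H$, $\nu(A)=1$, and for every formula $B(p_1,\dots,p_n)$ with $\nu(B)=1$ the formula $A\to B$ is valid in all algebras of $\mathcal V$. Let $FPSI(\mathcal V)$ be the class of all subdirectly irreducible algebras in $\mathcal V$ that have a presentation over $\mathcal V$. A characteristic formula of $\mathcal H\in FPSI(\mathcal V)$ over $\mathcal V$ is a formula $A\to B$, where $\langle A(p_1,\dots,p_n),\nu\rangle$ is a presentation of $\mathcal H$ over $\mathcal V$ and $B(p_1,\dots,p_n)$ is a formula such that $\nu(B)$ is the opremum of $\mathcal H$. The Jankov formula of a finite subdirectly irreducible algebra $\mathcal H=\{a_1,\dots,a_n\}$ is $D(p_1,\dots,p_n)\to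 p_\omega$, where $a_\omega$ is the opremum of $\mathcal H$ and $D$ is the conjunction of all formulas $(p_i\circ p_j)\leftrightarrow p_k$ with $a_i\circ a_j=a_k$, $\circ\in\{\land,\lor,\to\}$, and all $\neg p_i\leftrightarrow p_j$ with $\neg a_i=a_j$. A variety is axiomatized by characteristic (respectively Jankov) formulas if it is the class of all Heyting algebras validating some set of formulas that are characteristic formulas over one and the same variety (respectively Jankov formulas). Theorem. There is a continuum of varieties of Heyting algebras that are axiomatized by characteristic formulas but cannot be axiomatized by Jankov formulas: the set of these varieties has cardinality $2^{\aleph_0}$. More precisely, there are a variety $\mathcal V$ and infinite algebras $\mathcal H_0,\mathcal H_1,\dots\in FPSI(\mathcal V)$ such that for $k\neq m$ the algebra $\mathcal H_k$ is not embeddable into any homomorphic image of $\mathcal H_m$, and such that, for any choice of characteristic formulas $\chi_k$ of $\mathcal H_k$ over $\mathcal V$, 1. the set $\{\chi_k : k\in\mathbb N\}$ is $\mathcal V$-independent, that is, for each of its members there is an algebra in $\mathcal V$ that refutes it and validates all the other members; 2. for distinct sets $S\subseteq\mathbb N$ the varieties axiomatized by $\{\chi_k : k\in S\}$ are distinct;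 3. for every non-empty $S\subseteq\mathbb N$ the variety axiomatized by $\{\chi_k : k\in S\}$ cannot be axiomatized by Jankov formulas. -/

import Mathlib

namespace CharForm

/-- Propositional formulas in the signature `∧, ∨, →, ¬` over the variables `p₀, p₁, …`. -/
inductive PropForm : Type
  | var (i : ℕ) : PropForm
  | and (A B : PropForm) : PropForm
  | or (A B : PropForm) : PropForm
  | imp (A B : PropForm) : PropForm
  | neg (A : PropForm) : PropForm

namespace PropForm

/-- `A ↔ B` abbreviates `(A → B) ∧ (B → A)`. -/
def iff (A B : PropForm) : PropForm := (A.imp B).and (B.imp A)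

/-- The finite set of variables occurring in a formula. -/
def vars : PropForm → Finset ℕ
  | var i => {i}
  | and A B => A.vars ∪ B.vars
  | or A B => A.vars ∪ B.vars
  | imp A B => A.vars ∪ B.vars
  | neg A => A.vars

/-- The value of a formula in a Heyting algebra under a valuation of the variables. -/
def eval {H : Type} [HeytingAlgebra H] (ν : ℕ → H) : PropForm → H
  | var i => ν i
  | and A B => A.eval ν ⊓ B.eval ν
  | or A B => A.eval ν ⊔ B.eval ν
  | imp A B => A.eval ν ⇨ B.eval ν
  | neg A => (A.eval ν)ᶜ

/-- The conjunction of a list of formulas (a tautology if the list is empty). -/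
def conj : List PropForm → PropForm
  | [] => (var 0).imp (var 0)
  | [A] => A
  | A :: B :: l => A.and (conj (B :: l))

end PropForm

/-! ### Validity and varieties -/

/-- `H ⊨ A`: the formula `A` takes the value `1` under every valuation in `H`. -/
def Valid (H : HeytAlg.{0}) (A : PropForm) : Prop :=
  ∀ ν : ℕ → H, A.eval ν = ⊤

/-- The class of all Heyting algebras in which all formulas of `Γ` are valid. -/
def Mod (Γ : Set PropForm) : Set HeytAlg.{0} :=
  {H | ∀ A ∈ Γ, Valid H A}

/-- A variety (equational class) of Heyting algebras. In Heyting algebras every equation `s = t` is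
equivalent to the validity of `s ↔ t`, and the validity of `A` to the equation `A = (A → A)`. -/
def IsVariety (V : Set HeytAlg.{0}) : Prop :=
  ∃ Γ : Set PropForm, V = Mod Γ

/-- `Γ ⊢_V A`: every algebra of `V` that validates all formulas of `Γ` validates `A`. -/
def Derivable (V : Set HeytAlg.{0}) (Γ : Set PropForm) (A : PropForm) : Prop :=
  ∀ H ∈ V, (∀ C ∈ Γ, Valid H C) → Valid H A

/-- A set of formulas is `V`-independent if none of its members is derivable over `V` from the
other ones. -/
def Independent (V : Set HeytAlg.{0}) (Γ : Set PropForm) : Prop :=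
  ∀ A ∈ Γ, ¬ Derivable V (Γ \ {A}) A

/-- `A ∈ SH(B)`: `A` is embeddable into a homomorphic image of `B`. -/
def InSH (A B : HeytAlg.{0}) : Prop :=
  ∃ (C : HeytAlg.{0}) (f : HeytingHom B C) (g : HeytingHom A C),
    Function.Surjective f ∧ Function.Injective g

/-! ### Subdirectly irreducible and finitely presentable algebras -/

/-- A congruence of a Heyting algebra. -/
structure IsCongruence {H : Type} [HeytingAlgebra H] (θ : Setoid H) : Prop where
  inf : ∀ a b c d : H, θ a b → θ c d → θ (a ⊓ c) (b ⊓ d)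
  sup : ∀ a b c d : H, θ a b → θ c d → θ (a ⊔ c) (b ⊔ d)
  himp : ∀ a b c d : H, θ a b → θ c d → θ (a ⇨ c) (b ⇨ d)
  compl : ∀ a b : H, θ a b → θ aᶜ bᶜ

/-- Subdirect irreducibility: the intersection of all congruences different from equality is itself
different from equality. In particular the algebra is not degenerate. -/
def SubdirectlyIrreducible (H : Type) [HeytingAlgebra H] : Prop :=
  ∃ a b : H, a ≠ b ∧ ∀ θ : Setoid H, IsCongruence θ → θ ≠ ⊥ → θ a b

/-- The opremum: the greatest of the elements distinct from `1`. -/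
def IsOpremum {H : Type} [HeytingAlgebra H] (ω : H) : Prop :=
  IsGreatest {x : H | x ≠ ⊤} ω

/-- The set `G` generates the Heyting algebra `H`. -/
def Generates {H : Type} [HeytingAlgebra H] (G : Set H) : Prop :=
  ∀ T : Set H, G ⊆ T →
    (∀ a ∈ T, ∀ b ∈ T, a ⊓ b ∈ T ∧ a ⊔ b ∈ T ∧ a ⇨ b ∈ T) → (∀ a ∈ T, aᶜ ∈ T) → T = Set.univ

/-- The pair `⟨A, ν⟩`, where `A` is a formula in the variables from the finite list `P`, defines the
algebra `H` over `V`. -/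
structure Defines (V : Set HeytAlg.{0}) (P : Finset ℕ) (A : PropForm) (H : HeytAlg.{0})
    (ν : ℕ → H) : Prop where
  vars_subset : A.vars ⊆ P
  generates : Generates (ν '' (P : Set ℕ))
  eval_eq : A.eval ν = ⊤
  valid_imp : ∀ B : PropForm, B.vars ⊆ P → B.eval ν = ⊤ → ∀ K ∈ V, Valid K (A.imp B)

/-- `H` is finitely presentable over `V`. -/
def FinitelyPresentable (V : Set HeytAlg.{0}) (H : HeytAlg.{0}) : Prop :=
  ∃ (P : Finset ℕ) (A : PropForm) (ν : ℕ → H), Defines V P A H ν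

/-- The class of all subdirectly irreducible algebras of `V` that are finitely presentable
over `V`. -/
def FPSI (V : Set HeytAlg.{0}) : Set HeytAlg.{0} :=
  {H | H ∈ V ∧ SubdirectlyIrreducible H ∧ FinitelyPresentable V H}

/-! ### Characteristic formulas and Jankov formulas -/

/-- `χ` is a characteristic formula of the algebra `H` over the variety `V`: `H` is a subdirectly
irreducible algebra of `V` and `χ = A → B`, where `⟨A, ν⟩` is a presentation of `H` over `V` and
`ν(B)` is the opremum of `H`. -/
def IsCharFormula (V : Set HeytAlg.{0}) (H : HeytAlg.{0}) (χ : PropForm) : Prop :=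
  H ∈ V ∧ SubdirectlyIrreducible H ∧
    ∃ (P : Finset ℕ) (A B : PropForm) (ν : ℕ → H),
      Defines V P A H ν ∧ B.vars ⊆ P ∧ IsOpremum (B.eval ν) ∧ χ = A.imp B

/-- The diagram formula of the finite algebra `H = {e 0, …, e (n - 1)}`, in which the variable `pᵢ`
stands for the element `e i`. -/
def diagram {H : Type} [HeytingAlgebra H] {n : ℕ} (e : Fin n ≃ H) : PropForm :=
  let p : H → PropForm := fun a => .var (e.symm a : ℕ)
  let elems : List H := (List.finRange n).map e
  let pairs : List (H × H) := elems.product elems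
  .conj
    (pairs.map (fun a => ((p a.1).and (p a.2)).iff (p (a.1 ⊓ a.2))) ++
     pairs.map (fun a => ((p a.1).or (p a.2)).iff (p (a.1 ⊔ a.2))) ++
     pairs.map (fun a => ((p a.1).imp (p a.2)).iff (p (a.1 ⇨ a.2))) ++
     elems.map (fun a => (p a).neg.iff (p aᶜ)))

/-- `χ` is the Jankov formula of some finite subdirectly irreducible algebra (under some enumeration
of its elements). -/
def IsJankovFormula (χ : PropForm) : Prop :=
  ∃ (H : HeytAlg.{0}) (n : ℕ) (e : Fin n ≃ H) (ω : H),
    SubdirectlyIrreducible H ∧ IsOpremum ω ∧ χ = (diagram e).imp (.var (e.symm ω : ℕ))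

/-- The class `W` is axiomatized by characteristic formulas, all of them over one variety `V`. -/
def AxiomatizedByCharFormulas (W : Set HeytAlg.{0}) : Prop :=
  ∃ V : Set HeytAlg.{0}, IsVariety V ∧
    ∃ Γ : Set PropForm, (∀ χ ∈ Γ, ∃ H, IsCharFormula V H χ) ∧ W = Mod Γ

/-- The class `W` is axiomatized by Jankov formulas. -/
def AxiomatizedByJankovFormulas (W : Set HeytAlg.{0}) : Prop :=
  ∃ Γ : Set PropForm, (∀ χ ∈ Γ, IsJankovFormula χ) ∧ W = Mod Γ

end CharForm

/-!
A characteristic formula of `H` over `V` fails in an algebra `K` of `V` exactly if `H` is embeddable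
into a homomorphic image of `K`, so the characteristic formulas of algebras that are pairwise
incomparable in this sense are independent. If these algebras are infinite, a Jankov formula refuted
by one of them comes from a finite `F` in `V`; no infinite algebra is embeddable into an image of
`F`, so `F` validates all the characteristic formulas, but it refutes its own Jankov formula.

The incomparable algebras consist of the lower sets of frames in which a point `side` sits above an
isolated minimal point and the first `k + 4` rungs of the Rieger–Nishimura ladder. The formula
presenting the `k`-th algebra forces each point of the `m`-th frame that refutes `p₂` to recognize
the minimal points and hence the whole standard valuation, so that `m = k`; a point at which `p₂`
holds has a bounded morphism to the isolated point or to the ladder. The variety is the one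
generated by the algebras of the frames, so that both claims need only be checked on the frames.
-/

namespace CharForm

/-! ### Validity, homomorphic images and subalgebras -/

namespace PropForm

section Eval

variable {H K : Type} [HeytingAlgebra H] [HeytingAlgebra K]

theorem eval_hom (f : HeytingHom H K) (ν : ℕ → H) (A : PropForm) :
    A.eval (f ∘ ν) = f (A.eval ν) := by
  induction A with
  | var i => rfl
  | and A B ihA ihB => simp only [eval, ihA, ihB, map_inf]
  | or A B ihA ihB => simp only [eval, ihA, ihB, map_sup]
  | imp A B ihA ihB => simp only [eval, ihA, ihB, map_himp]
  | neg A ihA => simp only [eval, ihA, map_compl]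

theorem eval_congr {P : Finset ℕ} {ν μ : ℕ → H} (h : ∀ i ∈ P, ν i = μ i) {A : PropForm}
    (hA : A.vars ⊆ P) : A.eval ν = A.eval μ := by
  induction A with
  | var i => exact h i (by simpa only [vars, Finset.singleton_subset_iff] using hA)
  | neg A ihA => rw [eval, eval, ihA hA]
  | and A B ihA ihB | or A B ihA ihB | imp A B ihA ihB =>
    obtain ⟨hA, hB⟩ := Finset.union_subset_iff.1 hA
    rw [eval, eval, ihA hA, ihB hB]

theorem eval_iff_eq_top {ν : ℕ → H} {A B : PropForm} :
    (A.iff B).eval ν = ⊤ ↔ A.eval ν = B.eval ν := by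
  rw [iff, eval, inf_eq_top_iff, eval, eval, himp_eq_top_iff, himp_eq_top_iff]
  exact le_antisymm_iff.symm

theorem le_eval_conj {ν : ℕ → H} {a : H} {l : List PropForm} :
    a ≤ (conj l).eval ν ↔ ∀ A ∈ l, a ≤ A.eval ν := by
  induction l using conj.induct with
  | case1 =>
    simp only [conj, eval, himp_self, le_top, List.not_mem_nil, false_imp_iff, implies_true]
  | case2 A => simp only [conj, List.forall_mem_singleton]
  | case3 A B l ih => rw [conj, eval, le_inf_iff, ih, List.forall_mem_cons (a := A)]

theorem eval_conj_eq_top {ν : ℕ → H} {l : List PropForm} :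
    (conj l).eval ν = ⊤ ↔ ∀ A ∈ l, A.eval ν = ⊤ := by
  simp only [← top_le_iff, le_eval_conj]

end Eval

theorem vars_conj_subset {P : Finset ℕ} {l : List PropForm} (hl : l ≠ [])
    (h : ∀ A ∈ l, A.vars ⊆ P) : (conj l).vars ⊆ P := by
  induction l using conj.induct with
  | case1 => exact absurd rfl hl
  | case2 A => exact h A (List.mem_singleton_self A)
  | case3 A B l ih =>
    obtain ⟨hA, hl⟩ := List.forall_mem_cons.1 h
    exact Finset.union_subset hA (ih (List.cons_ne_nil B l) hl)

end PropForm

open PropForm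

section Images

variable {H K : HeytAlg.{0}} {A B : PropForm}

theorem Valid.of_surjective (hA : Valid H A) (f : HeytingHom H K) (hf : Function.Surjective f) :
    Valid K A := fun ν => by
  obtain ⟨μ, rfl⟩ := hf.comp_left ν
  rw [eval_hom, hA μ, map_top]

theorem Valid.of_injective (hA : Valid K A) (g : HeytingHom H K) (hg : Function.Injective g) :
    Valid H A := fun ν => hg <| by rw [← eval_hom, hA, map_top]

theorem InSH.valid (h : InSH H K) (hA : Valid K A) : Valid H A := by
  obtain ⟨C, f, g, hf, hg⟩ := h
  exact (hA.of_surjective f hf).of_injective g hg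

theorem InSH.finite (h : InSH H K) [Finite K] : Finite H := by
  obtain ⟨C, f, g, hf, hg⟩ := h
  have := Finite.of_surjective f hf
  exact Finite.of_injective g hg

theorem IsVariety.mem_of_inSH {V : Set HeytAlg.{0}} (hV : IsVariety V) (h : InSH H K)
    (hK : K ∈ V) : H ∈ V := by
  obtain ⟨Γ, rfl⟩ := hV
  exact fun A hA => h.valid (hK A hA)

end Images

/-! ### Quotients by principal filters -/

section Relativization

variable {K : Type*} [HeytingAlgebra K]

/-- The quotient of a Heyting algebra by the principal filter of `a`, realized on the interval of
elements below `a`. -/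
instance instHeytingAlgebraIic (a : K) : HeytingAlgebra (Set.Iic a) where
  himp x y := ⟨(x.1 ⇨ y.1) ⊓ a, inf_le_right⟩
  le_himp_iff x y z := by
    rw [← Subtype.coe_le_coe, ← Subtype.coe_le_coe]
    exact (le_inf_iff.trans (and_iff_left x.2)).trans le_himp_iff
  compl x := ⟨x.1ᶜ ⊓ a, inf_le_right⟩
  himp_bot x := Subtype.ext (congrArg (· ⊓ a) (himp_bot x.1))

theorem himp_inf_inf (x y a : K) : ((x ⊓ a) ⇨ (y ⊓ a)) ⊓ a = (x ⇨ y) ⊓ a := by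
  refine eq_of_forall_le_iff fun c => ?_
  simp only [le_inf_iff, le_himp_iff]
  refine and_congr_left fun hc => ?_
  rw [and_iff_left (inf_le_left.trans hc), inf_left_comm, inf_eq_left.2 hc, inf_comm]

/-- The quotient map onto the quotient by the principal filter of `a`. -/
def relativize (a : K) : HeytingHom K (Set.Iic a) where
  toFun x := ⟨x ⊓ a, inf_le_right⟩
  map_sup' x y := Subtype.ext (inf_sup_right x y a)
  map_inf' x y := Subtype.ext (inf_inf_distrib_right x y a)
  map_bot' := Subtype.ext (bot_inf_eq a)
  map_himp' x y := Subtype.ext (himp_inf_inf x y a).symm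

theorem relativize_surjective (a : K) : Function.Surjective (relativize a) := fun x =>
  ⟨x, Subtype.ext (inf_eq_left.2 x.2)⟩

theorem relativize_eq_top_iff {a x : K} : relativize a x = ⊤ ↔ a ≤ x :=
  Subtype.ext_iff.trans inf_eq_right

end Relativization

theorem valid_imp_iff {K : HeytAlg.{0}} {A B : PropForm} :
    Valid K (A.imp B) ↔ ∀ (C : HeytAlg.{0}) (f : HeytingHom K C), Function.Surjective f →
      ∀ μ : ℕ → C, A.eval μ = ⊤ → B.eval μ = ⊤ := by
  constructor
  · intro h C f hf μ hA
    have := h.of_surjective f hf μ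
    rwa [eval, hA, top_himp] at this
  · intro h ν
    rw [eval, himp_eq_top_iff, ← relativize_eq_top_iff, ← eval_hom]
    exact h (HeytAlg.of (Set.Iic (A.eval ν))) _ (relativize_surjective _) _
      (by rw [eval_hom, relativize_eq_top_iff])

/-! ### The opremum -/

section Opremum

variable {H : Type} [HeytingAlgebra H] {ω : H}

theorem IsOpremum.injective_of_map_ne_top (hω : IsOpremum ω) {K : Type} [HeytingAlgebra K]
    (f : HeytingHom H K) (hf : f ω ≠ ⊤) : Function.Injective f := by
  have le_of_map_le : ∀ x y, f x ≤ f y → x ≤ y := fun x y hxy => by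
    by_contra hle
    have hω' : x ⇨ y ≤ ω := hω.2 fun h => hle (himp_eq_top_iff.1 h)
    have htop : f (x ⇨ y) = ⊤ := by rwa [map_himp, himp_eq_top_iff]
    exact hf (top_unique (htop.ge.trans (OrderHomClass.mono f hω')))
  exact fun x y hxy => le_antisymm (le_of_map_le x y hxy.le) (le_of_map_le y x hxy.ge)

theorem IsOpremum.subdirectlyIrreducible (hω : IsOpremum ω) : SubdirectlyIrreducible H := by
  refine ⟨⊤, ω, hω.1.symm, fun θ hθ hne => ?_⟩
  by_contra hω'
  have eq_top : ∀ x, θ x ⊤ → x = ⊤ := fun x hx => by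
    by_contra hx'
    have := hθ.sup _ _ _ _ hx (θ.refl ω)
    rw [sup_eq_right.2 (hω.2 hx'), top_sup_eq] at this
    exact hω' (θ.symm this)
  have le_of_rel : ∀ x y, θ x y → x ≤ y := fun x y hxy => by
    have := hθ.himp _ _ _ _ hxy (θ.refl y)
    rw [himp_self] at this
    exact himp_eq_top_iff.1 (eq_top _ this)
  exact hne (le_bot_iff.1 fun x y hxy =>
    le_antisymm (le_of_rel x y hxy) (le_of_rel y x (θ.symm hxy)))

end Opremum

/-! ### Presentations and characteristic formulas -/

theorem generates_iff {H : Type} [HeytingAlgebra H] {P : Finset ℕ} {ν : ℕ → H} :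
    Generates (ν '' (P : Set ℕ)) ↔ ∀ x, ∃ A : PropForm, A.vars ⊆ P ∧ A.eval ν = x := by
  constructor
  · intro h x
    refine (h {x | ∃ A : PropForm, A.vars ⊆ P ∧ A.eval ν = x} ?_ ?_ ?_).ge (Set.mem_univ x)
    · rintro _ ⟨i, hi, rfl⟩
      exact ⟨var i, Finset.singleton_subset_iff.2 hi, rfl⟩
    · rintro _ ⟨A, hA, rfl⟩ _ ⟨B, hB, rfl⟩
      exact ⟨⟨A.and B, Finset.union_subset hA hB, rfl⟩, ⟨A.or B, Finset.union_subset hA hB, rfl⟩,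
        ⟨A.imp B, Finset.union_subset hA hB, rfl⟩⟩
    · rintro _ ⟨A, hA, rfl⟩
      exact ⟨A.neg, hA, rfl⟩
  · intro h T hT hbin hcompl
    have eval_mem : ∀ A : PropForm, A.vars ⊆ P → A.eval ν ∈ T := fun A hA => by
      induction A with
      | var i => exact hT ⟨i, Finset.singleton_subset_iff.1 hA, rfl⟩
      | neg A ihA => exact hcompl _ (ihA hA)
      | and A B ihA ihB | or A B ihA ihB | imp A B ihA ihB =>
        obtain ⟨hA, hB⟩ := Finset.union_subset_iff.1 hA
        obtain ⟨hinf, hsup, himp⟩ := hbin _ (ihA hA) _ (ihB hB)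
        assumption
    refine Set.eq_univ_of_forall fun x => ?_
    obtain ⟨A, hA, rfl⟩ := h x
    exact eval_mem A hA

theorem Generates.exists_hom {H K : Type} [HeytingAlgebra H] [HeytingAlgebra K] {P : Finset ℕ}
    {ν : ℕ → H} {μ : ℕ → K} (hν : Generates (ν '' (P : Set ℕ)))
    (h : ∀ A : PropForm, A.vars ⊆ P → A.eval ν = ⊤ → A.eval μ = ⊤) :
    ∃ g : HeytingHom H K, ∀ A : PropForm, A.vars ⊆ P → g (A.eval ν) = A.eval μ := by
  have congr : ∀ A B : PropForm, A.vars ⊆ P → B.vars ⊆ P → A.eval ν = B.eval ν →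
      A.eval μ = B.eval μ := fun A B hA hB hAB =>
    eval_iff_eq_top.1 <| h _ (Finset.union_subset (Finset.union_subset hA hB)
      (Finset.union_subset hB hA)) (eval_iff_eq_top.2 hAB)
  choose E hEP hEν using generates_iff.1 hν
  have hE : ∀ x y, (E x).vars ∪ (E y).vars ⊆ P := fun x y => Finset.union_subset (hEP x) (hEP y)
  refine ⟨⟨⟨⟨fun x => (E x).eval μ, ?_⟩, ?_⟩, ?_, ?_⟩, fun A hA => congr _ A (hEP _) hA (hEν _)⟩
  · exact fun x y => congr _ ((E x).or (E y)) (hEP _) (hE x y) (by simp only [eval, hEν])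
  · exact fun x y => congr _ ((E x).and (E y)) (hEP _) (hE x y) (by simp only [eval, hEν])
  · refine (congr _ ((E ⊥).and (E ⊥).neg) (hEP _) (hE ⊥ ⊥) ?_).trans (inf_compl_self _)
    simp only [eval, hEν, inf_compl_self]
  · exact fun x y => congr _ ((E x).imp (E y)) (hEP _) (hE x y) (by simp only [eval, hEν])

theorem IsCharFormula.not_valid {V : Set HeytAlg.{0}} {H : HeytAlg.{0}} {χ : PropForm}
    (h : IsCharFormula V H χ) : ¬ Valid H χ := by
  obtain ⟨-, -, P, A, B, ν, hAν, -, hω, rfl⟩ := h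
  intro hvalid
  have := hvalid ν
  rw [eval, hAν.eval_eq, top_himp] at this
  exact hω.1 this

theorem IsCharFormula.inSH {V : Set HeytAlg.{0}} {H K : HeytAlg.{0}} {χ : PropForm}
    (h : IsCharFormula V H χ) (hK : K ∈ V) (hχ : ¬ Valid K χ) : InSH H K := by
  obtain ⟨-, -, P, A, B, ν, hAν, hB, hω, rfl⟩ := h
  rw [valid_imp_iff] at hχ
  push Not at hχ
  obtain ⟨C, f, hf, μ, hA, hBμ⟩ := hχ
  obtain ⟨g, hg⟩ := hAν.generates.exists_hom fun F hF hFν =>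
    valid_imp_iff.1 (hAν.valid_imp F hF hFν K hK) C f hf μ hA
  exact ⟨C, f, g, hf, hω.injective_of_map_ne_top g (by rwa [hg B hB])⟩

theorem IsCharFormula.valid_of_finite {V : Set HeytAlg.{0}} {H K : HeytAlg.{0}} {χ : PropForm}
    (h : IsCharFormula V H χ) [Infinite H] (hK : K ∈ V) [Finite K] : Valid K χ := by
  by_contra hχ
  exact not_finite_iff_infinite.2 ‹Infinite H› (h.inSH hK hχ).finite

/-! ### Jankov formulas -/

section Jankov

variable {F : HeytAlg.{0}} {n : ℕ} (e : Fin n ≃ F)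

theorem eval_diagram_eq_top_iff {K : Type} [HeytingAlgebra K] {μ : ℕ → K} :
    (diagram e).eval μ = ⊤ ↔
      (∀ x y : F, μ (e.symm x) ⊓ μ (e.symm y) = μ (e.symm (x ⊓ y))) ∧
      (∀ x y : F, μ (e.symm x) ⊔ μ (e.symm y) = μ (e.symm (x ⊔ y))) ∧
      (∀ x y : F, (μ (e.symm x) ⇨ μ (e.symm y)) = μ (e.symm (x ⇨ y))) ∧
      ∀ x : F, (μ (e.symm x))ᶜ = μ (e.symm xᶜ) := by
  have mem_elems : ∀ x, x ∈ (List.finRange n).map e := fun x =>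
    List.mem_map.2 ⟨e.symm x, List.mem_finRange _, e.apply_symm_apply x⟩
  have mem_pairs : ∀ x y, (x, y) ∈ ((List.finRange n).map e).product ((List.finRange n).map e) :=
    fun x y => List.pair_mem_product.2 ⟨mem_elems x, mem_elems y⟩
  simp only [diagram, eval_conj_eq_top, List.forall_mem_append, List.forall_mem_map,
    eval_iff_eq_top, eval, Prod.forall, mem_pairs, mem_elems, true_imp_iff, and_assoc]

theorem diagram_vars_subset : (diagram e).vars ⊆ Finset.range n := by
  refine vars_conj_subset ?_ ?_
  · have hne : List.finRange n ≠ [] := List.ne_nil_of_mem (List.mem_finRange (e.symm ⊤))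
    simp only [ne_eq, List.append_eq_nil_iff, List.map_eq_nil_iff, not_and]
    exact fun _ h => absurd h hne
  · simp only [List.forall_mem_append, List.forall_mem_map, PropForm.iff, vars, Finset.subset_iff,
      Finset.mem_union, Finset.mem_singleton, Finset.mem_range]
    grind

theorem exists_hom_of_eval_diagram {K : Type} [HeytingAlgebra K] {μ : ℕ → K}
    (h : (diagram e).eval μ = ⊤) : ∃ g : HeytingHom F K, ∀ x, g x = μ (e.symm x) := by
  obtain ⟨hinf, hsup, himp, hcompl⟩ := (eval_diagram_eq_top_iff e).1 h
  have htop : μ (e.symm ⊤) = ⊤ := by rw [← himp_self (a := (⊤ : F)), ← himp, himp_self]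
  have hbot : μ (e.symm ⊥) = ⊥ := by rw [← compl_top, ← hcompl, htop, compl_top]
  exact ⟨⟨⟨⟨fun x => μ (e.symm x), fun x y => (hsup x y).symm⟩, fun x y => (hinf x y).symm⟩, hbot,
    fun x y => (himp x y).symm⟩, fun _ => rfl⟩

theorem defines_diagram : ∃ ν : ℕ → F, (∀ i : Fin n, ν i = e i) ∧
    Defines Set.univ (Finset.range n) (diagram e) F ν := by
  let ν : ℕ → F := fun i => if h : i < n then e ⟨i, h⟩ else ⊤
  have hν : ∀ i : Fin n, ν i = e i := fun i => dif_pos i.2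
  have hν_symm : ∀ x : F, ν (e.symm x) = x := fun x => (hν _).trans (e.apply_symm_apply x)
  refine ⟨ν, hν, diagram_vars_subset e, generates_iff.2 fun x => ⟨var (e.symm x), ?_, hν_symm x⟩,
    ?_, fun B hB hBν K _ => valid_imp_iff.2 fun C f _ μ hμ => ?_⟩
  · exact Finset.singleton_subset_iff.2 (Finset.mem_range.2 (e.symm x).2)
  · simp only [eval_diagram_eq_top_iff, hν_symm, implies_true, and_self]
  · obtain ⟨g, hg⟩ := exists_hom_of_eval_diagram e hμ
    have hμ_eq : ∀ i ∈ Finset.range n, μ i = (g ∘ ν) i := fun i hi => by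
      have := hν ⟨i, Finset.mem_range.1 hi⟩
      simp only [Function.comp_apply, hg]
      rw [this, e.symm_apply_apply]
    rw [eval_congr hμ_eq hB, eval_hom, hBν, map_top]

theorem IsJankovFormula.exists_isCharFormula {χ : PropForm} (h : IsJankovFormula χ) :
    ∃ F : HeytAlg.{0}, Finite F ∧ IsCharFormula Set.univ F χ := by
  obtain ⟨F, n, e, ω, hF, hω, rfl⟩ := h
  obtain ⟨ν, hν, hdef⟩ := defines_diagram e
  refine ⟨F, Finite.of_equiv _ e, Set.mem_univ F, hF, Finset.range n, diagram e, var (e.symm ω), ν,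
    hdef, Finset.singleton_subset_iff.2 (Finset.mem_range.2 (e.symm ω).2), ?_, rfl⟩
  rwa [eval, hν, e.apply_symm_apply]

end Jankov

/-! ### Independent characteristic formulas -/

section Antichain

variable {ι : Type*} {V : Set HeytAlg.{0}} {H : ι → HeytAlg.{0}} {χ : ι → PropForm}

theorem valid_charFormula_iff (hSH : Pairwise fun k m => ¬ InSH (H k) (H m))
    (hχ : ∀ k, IsCharFormula V (H k) (χ k)) {k m : ι} : Valid (H m) (χ k) ↔ k ≠ m := by
  refine ⟨?_, fun hkm => not_not.1 fun h => hSH hkm ((hχ k).inSH (hχ m).1 h)⟩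
  rintro h rfl
  exact (hχ k).not_valid h

theorem mem_mod_image_iff (hSH : Pairwise fun k m => ¬ InSH (H k) (H m))
    (hχ : ∀ k, IsCharFormula V (H k) (χ k)) {S : Set ι} {m : ι} :
    H m ∈ Mod (χ '' S) ↔ m ∉ S := by
  simp only [Mod, Set.mem_ofPred_eq, Set.forall_mem_image, valid_charFormula_iff hSH hχ]
  exact ⟨fun h hm => h hm rfl, fun h k hk hkm => h (hkm ▸ hk)⟩

theorem mod_image_injective (hSH : Pairwise fun k m => ¬ InSH (H k) (H m))
    (hχ : ∀ k, IsCharFormula V (H k) (χ k)) :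
    Function.Injective fun S : Set ι => Mod (χ '' S) := fun S T hST => by
  ext m
  rw [← not_iff_not, ← mem_mod_image_iff hSH hχ, ← mem_mod_image_iff hSH hχ]
  exact iff_of_eq (congrArg (H m ∈ ·) hST)

theorem independent_range (hSH : Pairwise fun k m => ¬ InSH (H k) (H m))
    (hχ : ∀ k, IsCharFormula V (H k) (χ k)) : Independent V (Set.range χ) := by
  rintro _ ⟨m, rfl⟩ hder
  refine (hχ m).not_valid (hder (H m) (hχ m).1 ?_)
  rintro _ ⟨⟨k, rfl⟩, hkm⟩
  exact (valid_charFormula_iff hSH hχ).2 fun h => hkm (congrArg χ h)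

theorem not_axiomatizedByJankovFormulas (hV : IsVariety V) {Γ : Set PropForm} (hne : Γ.Nonempty)
    (hΓ : ∀ γ ∈ Γ, ∃ K : HeytAlg.{0}, Infinite K ∧ IsCharFormula V K γ) :
    ¬ AxiomatizedByJankovFormulas (Mod Γ) := by
  rintro ⟨Δ, hΔ, hmod⟩
  obtain ⟨γ, hγ⟩ := hne
  obtain ⟨K, -, hK⟩ := hΓ γ hγ
  have hKΔ : K ∉ Mod Δ := hmod ▸ fun h => hK.not_valid (h γ hγ)
  simp only [Mod, Set.mem_ofPred_eq, not_forall, exists_prop] at hKΔ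
  obtain ⟨δ, hδ, hKδ⟩ := hKΔ
  obtain ⟨F, hF, hFδ⟩ := (hΔ δ hδ).exists_isCharFormula
  have hFV : F ∈ V := hV.mem_of_inSH (hFδ.inSH (Set.mem_univ K) hKδ) hK.1
  have hFΓ : F ∈ Mod Γ := fun γ' hγ' => by
    obtain ⟨K', hK', hχ⟩ := hΓ γ' hγ'
    exact hχ.valid_of_finite hFV
  exact hFδ.not_valid ((hmod ▸ hFΓ) δ hδ)

theorem not_axiomatizedByJankovFormulas_image (hV : IsVariety V) (hH : ∀ k, Infinite (H k))
    (hχ : ∀ k, IsCharFormula V (H k) (χ k)) {S : Set ι} (hS : S.Nonempty) :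
    ¬ AxiomatizedByJankovFormulas (Mod (χ '' S)) :=
  not_axiomatizedByJankovFormulas hV (hS.image χ) <|
    Set.forall_mem_image.2 fun k _ => ⟨H k, hH k, hχ k⟩

end Antichain

deriving instance Countable for PropForm

section Cardinality

open Cardinal

theorem mk_isVariety_le : #{W // IsVariety W} ≤ 𝔠 := by
  have hrange : {W | IsVariety W} = Set.range Mod :=
    Set.ext fun W => exists_congr fun Γ => eq_comm
  have hform : #(Set PropForm) ≤ 𝔠 := by
    rw [mk_set, ← two_power_aleph0]
    exact power_le_power_left two_ne_zero (mk_le_aleph0 (α := PropForm))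
  have hle := mk_range_le_lift (f := Mod)
  rw [← hrange, lift_id'.{0, 1}] at hle
  exact hle.trans ((lift_le.2 hform).trans_eq lift_continuum)

theorem mk_nonempty_set_nat : #{S : Set ℕ // S.Nonempty} = 𝔠 := by
  have hcompl : {S : Set ℕ | S.Nonempty} = {∅}ᶜ := Set.ext fun S => Set.nonempty_iff_ne_empty
  have hlt : #({∅} : Set (Set ℕ)) < #(Set ℕ) := by
    rw [mk_singleton, mk_set_nat]
    exact one_lt_aleph0.trans aleph0_lt_continuum
  rw [← mk_set_nat, ← mk_compl_of_infinite {∅} hlt, ← hcompl]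
  rfl

theorem mk_axiomatizedByCharFormulas {V : Set HeytAlg.{0}} (hV : IsVariety V)
    {H : ℕ → HeytAlg.{0}} (hH : ∀ k, Infinite (H k))
    (hSH : Pairwise fun k m => ¬ InSH (H k) (H m)) {χ : ℕ → PropForm}
    (hχ : ∀ k, IsCharFormula V (H k) (χ k)) :
    #{W // IsVariety W ∧ AxiomatizedByCharFormulas W ∧ ¬ AxiomatizedByJankovFormulas W} = 𝔠 := by
  refine le_antisymm ((mk_subtype_mono fun W hW => hW.1).trans mk_isVariety_le) ?_
  let f (S : {S : Set ℕ // S.Nonempty}) :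
      {W // IsVariety W ∧ AxiomatizedByCharFormulas W ∧ ¬ AxiomatizedByJankovFormulas W} :=
    ⟨Mod (χ '' S), ⟨_, rfl⟩, ⟨V, hV, _, Set.forall_mem_image.2 fun k _ => ⟨H k, hχ k⟩, rfl⟩,
      not_axiomatizedByJankovFormulas_image hV hH hχ S.2⟩
  have hf : Function.Injective f := fun S T hST =>
    Subtype.ext (mod_image_injective hSH hχ (congrArg Subtype.val hST))
  have hle := lift_mk_le'.2 ⟨⟨f, hf⟩⟩
  rwa [mk_nonempty_set_nat, lift_continuum, lift_id'.{0, 1}] at hle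

end Cardinality

/-! ### Kripke semantics on lower sets -/

section LowerSets

variable {α : Type*} [Preorder α]

theorem mem_himp {U W : LowerSet α} {x : α} : x ∈ U ⇨ W ↔ ∀ y ≤ x, y ∈ U → y ∈ W := by
  rw [← LowerSet.Iic_le, le_himp_iff]
  exact ⟨fun h y hy hU => h ⟨hy, hU⟩, fun h y hy => h y hy.1 hy.2⟩

theorem mem_compl {U : LowerSet α} {x : α} : x ∈ Uᶜ ↔ ∀ y ≤ x, y ∉ U := by
  rw [← himp_bot, mem_himp]
  rfl

theorem ideal_le_sup_iff {I : Order.Ideal α} {U W : LowerSet α} :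
    I.toLowerSet ≤ U ⊔ W ↔ I.toLowerSet ≤ U ∨ I.toLowerSet ≤ W := by
  refine ⟨fun h => ?_, fun h => h.elim le_sup_of_le_left le_sup_of_le_right⟩
  by_contra! hUW
  obtain ⟨⟨b, hb, hbU⟩, c, hc, hcW⟩ := hUW.imp Set.not_subset.1 Set.not_subset.1
  obtain ⟨d, hd, hbd, hcd⟩ := I.directed b hb c hc
  exact (h hd).elim (fun hU => hbU (U.lower hbd hU)) fun hW => hcW (W.lower hcd hW)

theorem principal_le_iff {b : α} {U : LowerSet α} :
    (Order.Ideal.principal b).toLowerSet ≤ U ↔ b ∈ U := LowerSet.Iic_le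

end LowerSets

section Kripke

variable {α β : Type} [Preorder α] [Preorder β]

section Eval

variable {μ : ℕ → LowerSet α} {A B : PropForm} {x : α}

theorem mem_eval_var {i : ℕ} : x ∈ (var i).eval μ ↔ x ∈ μ i := Iff.rfl

theorem mem_eval_and : x ∈ (A.and B).eval μ ↔ x ∈ A.eval μ ∧ x ∈ B.eval μ := Iff.rfl

theorem mem_eval_or : x ∈ (A.or B).eval μ ↔ x ∈ A.eval μ ∨ x ∈ B.eval μ := Iff.rfl

theorem mem_eval_imp : x ∈ (A.imp B).eval μ ↔ ∀ y ≤ x, y ∈ A.eval μ → y ∈ B.eval μ := mem_himp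

theorem mem_eval_neg : x ∈ A.neg.eval μ ↔ ∀ y ≤ x, y ∉ A.eval μ := mem_compl

theorem mem_eval_conj {l : List PropForm} : x ∈ (conj l).eval μ ↔ ∀ A ∈ l, x ∈ A.eval μ := by
  simp only [← LowerSet.Iic_le, le_eval_conj]

end Eval

/-- A bounded morphism from the points below `x` in the model `μ` to the model `ν`, as far as the
variables of `P` are concerned. Its values are ideals, that is points of the completion of `β`: a
directed family of points of `β` may be needed as the image of a single point. -/
structure IsBoundedMorphism (P : Finset ℕ) (μ : ℕ → LowerSet α) (ν : ℕ → LowerSet β) (x : α)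
    (τ : α → Order.Ideal β) : Prop where
  mem_iff : ∀ y ≤ x, ∀ i ∈ P, y ∈ μ i ↔ (τ y).toLowerSet ≤ ν i
  mono : ∀ y ≤ x, ∀ z ≤ y, τ z ≤ τ y
  exists_principal : ∀ y ≤ x, ∀ b ∈ τ y, ∃ z ≤ y, τ z = Order.Ideal.principal b

theorem IsBoundedMorphism.mem_eval_iff {P : Finset ℕ} {μ : ℕ → LowerSet α} {ν : ℕ → LowerSet β}
    {x : α} {τ : α → Order.Ideal β} (hτ : IsBoundedMorphism P μ ν x τ) {A : PropForm}
    (hA : A.vars ⊆ P) {y : α} (hy : y ≤ x) : y ∈ A.eval μ ↔ (τ y).toLowerSet ≤ A.eval ν := by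
  induction A generalizing y with
  | var i => exact hτ.mem_iff y hy i (Finset.singleton_subset_iff.1 hA)
  | and A B ihA ihB =>
    obtain ⟨hA, hB⟩ := Finset.union_subset_iff.1 hA
    rw [mem_eval_and, ihA hA hy, ihB hB hy, eval, le_inf_iff]
  | or A B ihA ihB =>
    obtain ⟨hA, hB⟩ := Finset.union_subset_iff.1 hA
    rw [mem_eval_or, ihA hA hy, ihB hB hy, eval, ideal_le_sup_iff]
  | imp A B ihA ihB =>
    obtain ⟨hA, hB⟩ := Finset.union_subset_iff.1 hA
    rw [mem_eval_imp, eval, le_himp_iff]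
    constructor
    · intro h b hb
      obtain ⟨z, hz, hzb⟩ := hτ.exists_principal y hy b hb.1
      have := h z hz
      rw [ihA hA (hz.trans hy), ihB hB (hz.trans hy), hzb, principal_le_iff, principal_le_iff]
        at this
      exact this hb.2
    · intro h z hz hzA
      rw [ihA hA (hz.trans hy)] at hzA
      rw [ihB hB (hz.trans hy)]
      exact (le_inf (hτ.mono y hy z hz) hzA).trans h
  | neg A ihA =>
    rw [mem_eval_neg, eval, le_compl_iff_disjoint_right, disjoint_iff_inf_le]
    constructor
    · intro h b hb
      obtain ⟨z, hz, hzb⟩ := hτ.exists_principal y hy b hb.1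
      have := h z hz
      rw [ihA hA (hz.trans hy), hzb, principal_le_iff] at this
      exact this hb.2
    · intro h z hz hzA
      rw [ihA hA (hz.trans hy)] at hzA
      obtain ⟨b, hb⟩ := (τ z).nonempty
      exact h ⟨hτ.mono y hy z hz hb, hzA hb⟩

end Kripke

/-! ### The Rieger–Nishimura sequence -/

section Segments

variable {α : Type} [Preorder α] {μ : ℕ → LowerSet α} {x z : α} {m n : ℕ}

/-- Formulas in `p₀` cutting out the initial segments of the Rieger–Nishimura ladder: `sₙ` holds at
the `m`-th rung if and only if `m < n`. -/
def segForm : ℕ → PropForm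
  | 0 => (var 0).and (var 0).neg
  | 1 => var 0
  | n + 2 => (segForm (n + 1)).or ((segForm (n + 1)).imp (segForm n))

theorem segForm_vars (n : ℕ) : (segForm n).vars = {0} := by
  induction n using segForm.induct with
  | case1 | case2 => rfl
  | case3 n ih₁ ih₂ => simp only [segForm, vars, ih₁, ih₂, Finset.union_self]

theorem not_mem_segForm_zero : x ∉ (segForm 0).eval μ := fun h => mem_eval_neg.1 h.2 x le_rfl h.1

theorem segForm_eval_mono : Monotone fun n => (segForm n).eval μ := by
  refine monotone_nat_of_le_succ fun n => ?_
  cases n with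
  | zero => exact inf_le_left
  | succ n => exact le_sup_left

variable (μ x n) in
/-- In the model `μ`, the point `x` looks like the `n`-th rung of the Rieger–Nishimura ladder. -/
def IsLevel : Prop := x ∈ (segForm (n + 1)).eval μ ∧ x ∉ (segForm n).eval μ

theorem IsLevel.mem_segForm_iff (hx : IsLevel μ x n) : x ∈ (segForm m).eval μ ↔ n < m :=
  ⟨fun h => not_le.1 fun hmn => hx.2 (segForm_eval_mono hmn h), fun h => segForm_eval_mono h hx.1⟩

theorem exists_isLevel_of_not_mem (hx : x ∉ (segForm (n + 2)).eval μ) : ∃ z ≤ x, IsLevel μ z n := by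
  simp only [segForm, mem_eval_or, mem_eval_imp, not_or, not_forall, exists_prop] at hx
  exact hx.2

theorem IsLevel.eq_or_add_two_le (hx : IsLevel μ x n) (hz : IsLevel μ z m) (hzx : z ≤ x) :
    m = n ∨ m + 2 ≤ n := by
  have hmn : m < n + 1 := hz.mem_segForm_iff.1 (LowerSet.lower _ hzx hx.1)
  suffices n ≠ m + 1 by lia
  rintro rfl
  exact hz.2 (mem_eval_imp.1 (hx.1.resolve_left hx.2) z hzx hz.1)

theorem IsLevel.exists_of_add_two_le (hx : IsLevel μ x n) (hmn : m + 2 ≤ n) :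
    ∃ z ≤ x, IsLevel μ z m :=
  exists_isLevel_of_not_mem fun h => by
    have := hx.mem_segForm_iff.1 h
    lia

theorem exists_isLevel_or_forall_not_mem (μ : ℕ → LowerSet α) (x : α) :
    (∃ n, IsLevel μ x n) ∨ ∀ n, x ∉ (segForm n).eval μ := by
  refine or_iff_not_imp_left.2 fun h n => ?_
  induction n with
  | zero => exact not_mem_segForm_zero
  | succ n ih => exact fun hn => h ⟨n, hn, ih⟩

end Segments

/-! ### The frames -/

/-- The points of the `k`-th frame: the Rieger–Nishimura ladder together with an isolated minimal
point `tip`, a point `side` above `tip` and the first `k + 4` rungs, and a greatest point. -/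
inductive LadderFrame (k : ℕ) : Type
  | rung (n : ℕ) : LadderFrame k
  | tip : LadderFrame k
  | side : LadderFrame k
  | root : LadderFrame k

namespace LadderFrame

variable {k m n : ℕ} {x : LadderFrame k}

/-- The order of the frame; truth is inherited downwards, so that the values of formulas are lower
sets. -/
protected def le : LadderFrame k → LadderFrame k → Prop
  | rung m, rung n => m = n ∨ m + 2 ≤ n
  | rung m, side => m < k + 4
  | tip, tip => True
  | tip, side => True
  | side, side => True
  | _, root => True
  | _, _ => False

instance : PartialOrder (LadderFrame k) where
  le := LadderFrame.le
  le_refl x := by cases x <;> simp [LadderFrame.le]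
  le_trans x y z hxy hyz := by
    cases x <;> cases y <;> cases z <;> simp [LadderFrame.le] at * <;> lia
  le_antisymm x y hxy hyx := by
    cases x <;> cases y <;> simp [LadderFrame.le] at *
    lia

@[simp, grind =] theorem rung_le_rung_iff :
    (rung m : LadderFrame k) ≤ rung n ↔ m = n ∨ m + 2 ≤ n := Iff.rfl
@[simp, grind =] theorem rung_le_side_iff : (rung m : LadderFrame k) ≤ side ↔ m < k + 4 := Iff.rfl
@[simp, grind .] theorem tip_le_side : (tip : LadderFrame k) ≤ side := trivial
@[simp, grind .] theorem le_root (x : LadderFrame k) : x ≤ root := by cases x <;> trivial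
@[simp, grind .] theorem not_rung_le_tip : ¬ (rung n : LadderFrame k) ≤ tip := id
@[simp, grind .] theorem not_tip_le_rung : ¬ (tip : LadderFrame k) ≤ rung n := id
@[simp, grind .] theorem not_side_le_rung : ¬ (side : LadderFrame k) ≤ rung n := id
@[simp, grind .] theorem not_side_le_tip : ¬ (side : LadderFrame k) ≤ tip := id
@[simp, grind .] theorem not_root_le_rung : ¬ (root : LadderFrame k) ≤ rung n := id
@[simp, grind .] theorem not_root_le_tip : ¬ (root : LadderFrame k) ≤ tip := id
@[simp, grind .] theorem not_root_le_side : ¬ (root : LadderFrame k) ≤ side := id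

protected theorem forall_iff {P : LadderFrame k → Prop} :
    (∀ x, P x) ↔ (∀ n, P (rung n)) ∧ P tip ∧ P side ∧ P root :=
  ⟨fun h => ⟨fun n => h _, h _, h _, h _⟩, fun ⟨hr, ht, hs, hroot⟩ x => by
    cases x
    exacts [hr _, ht, hs, hroot]⟩

theorem isMin_iff : IsMin x ↔ x = rung 0 ∨ x = rung 1 ∨ x = tip := by
  constructor
  · intro hx
    cases x with
    | rung n =>
      have h : ∀ j, ¬ j + 2 ≤ n := fun j hj => by
        have := hx (rung_le_rung_iff.2 (.inr hj))
        rw [rung_le_rung_iff] at this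
        lia
      have := h 0
      have : n = 0 ∨ n = 1 := by lia
      simpa using this
    | tip => exact .inr (.inr rfl)
    | side => exact absurd (hx tip_le_side) not_side_le_tip
    | root => exact absurd (hx (le_root side)) not_root_le_side
  · rintro (rfl | rfl | rfl) y hy <;> cases y <;> grind

theorem exists_isMin_le (x : LadderFrame k) : ∃ b ≤ x, IsMin b := by
  simp only [isMin_iff]
  cases x with
  | rung n =>
    obtain rfl | hn := eq_or_ne n 1
    · exact ⟨rung 1, le_rfl, by simp⟩
    · exact ⟨rung 0, rung_le_rung_iff.2 (by lia), by simp⟩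
  | tip => exact ⟨tip, le_rfl, by simp⟩
  | side => exact ⟨tip, tip_le_side, by simp⟩
  | root => exact ⟨tip, le_root tip, by simp⟩

theorem side_le_of_rung_zero_of_tip (h₀ : rung 0 ≤ x) (h : tip ≤ x) : side ≤ x := by
  cases x <;> grind

theorem rung_zero_or_rung_one_le (h : x ≠ tip) : rung 0 ≤ x ∨ rung 1 ≤ x := by
  cases x <;> grind

theorem rung_one_or_rung_two_or_tip_le (h : x ≠ rung 0) : rung 1 ≤ x ∨ rung 2 ≤ x ∨ tip ≤ x := by
  cases x <;> grind

theorem eq_rung_one (h₀ : ¬ rung 0 ≤ x) (h : ¬ tip ≤ x) : x = rung 1 := by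
  cases x <;> grind

theorem eq_rung_zero_or_two (h₁ : ¬ rung 1 ≤ x) (h : ¬ tip ≤ x) : x = rung 0 ∨ x = rung 2 := by
  cases x <;> grind

/-- The standard valuation of the `k`-th frame: `p₀` holds at the first rung only, `p₁` at the tip
only, and `p₂` at the rungs and the tip. -/
def stdVal (k : ℕ) : ℕ → LowerSet (LadderFrame k)
  | 0 => LowerSet.Iic (rung 0)
  | 1 => LowerSet.Iic tip
  | _ => (UpperSet.Ici side).compl

theorem mem_stdVal_zero {x : LadderFrame k} : x ∈ stdVal k 0 ↔ x = rung 0 := by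
  cases x <;> simp [stdVal]

theorem mem_stdVal_one {x : LadderFrame k} : x ∈ stdVal k 1 ↔ x = tip := by
  cases x <;> simp [stdVal]

theorem mem_stdVal_two {x : LadderFrame k} : x ∈ stdVal k 2 ↔ ¬ side ≤ x := Iff.rfl

theorem rung_mem_segForm_iff : rung m ∈ (segForm n).eval (stdVal k) ↔ m < n := by
  induction n using segForm.induct generalizing m with
  | case1 => simp [not_mem_segForm_zero]
  | case2 => simp [segForm, mem_eval_var, mem_stdVal_zero]
  | case3 n ih₁ ih₂ =>
    simp only [segForm, mem_eval_or, mem_eval_imp, LadderFrame.forall_iff, ih₁, ih₂,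
      rung_le_rung_iff, not_tip_le_rung, not_side_le_rung, not_root_le_rung]
    grind

theorem rung_mem_imp_segForm_iff :
    rung m ∈ ((segForm (n + 1)).imp (segForm n)).eval (stdVal k) ↔
      (rung m : LadderFrame k) ≤ rung (n + 1) := by
  simp only [mem_eval_imp, LadderFrame.forall_iff, rung_mem_segForm_iff, rung_le_rung_iff,
    not_tip_le_rung, not_side_le_rung, not_root_le_rung, false_imp_iff, and_true]
  refine ⟨fun h => ?_, by lia⟩
  have := h n
  lia

theorem rung_mem_var_two_imp_segForm_iff :
    rung m ∈ ((var 2).imp (segForm n)).eval (stdVal k) ↔ m < n := by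
  simp only [mem_eval_imp, mem_eval_var, mem_stdVal_two, LadderFrame.forall_iff,
    rung_mem_segForm_iff, rung_le_rung_iff, not_side_le_rung, not_false_eq_true, true_imp_iff,
    not_tip_le_rung, not_root_le_rung, false_imp_iff, and_true]
  exact ⟨fun h => h m (.inl rfl), by lia⟩

theorem tip_mem_segForm : tip ∈ (segForm (n + 2)).eval (stdVal k) := by
  refine segForm_eval_mono (Nat.le_add_left 2 n) (.inr (mem_eval_imp.2 fun y hy hy' => ?_))
  obtain rfl : y = rung 0 := mem_stdVal_zero.1 hy'
  exact absurd hy not_rung_le_tip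

theorem side_mem_imp_segForm_iff :
    side ∈ ((var 2).imp (segForm (n + 2))).eval (stdVal k) ↔ k + 2 ≤ n := by
  simp only [mem_eval_imp, LadderFrame.forall_iff, rung_le_side_iff, mem_eval_var, mem_stdVal_two,
    rung_mem_segForm_iff, not_root_le_side, tip_mem_segForm, not_side_le_rung, le_refl, not_true,
    not_false_eq_true, true_imp_iff, false_imp_iff, implies_true, and_true]
  exact ⟨fun h => not_lt.1 fun hnk => (h (n + 2) (by lia)).false, fun h j hj => by lia⟩

theorem root_not_mem_imp_segForm : root ∉ ((var 2).imp (segForm n)).eval (stdVal k) := fun h =>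
  lt_irrefl n (rung_mem_segForm_iff.1
    (mem_eval_imp.1 h (rung n) (le_root _) (mem_stdVal_two.2 not_side_le_rung)))

end LadderFrame

/-! ### The presentation -/

/-- The formula presenting the algebra of the `k`-th frame. At a point refuting `p₂` it enforces
three kinds of minimal points below, a point at which `p₀` is dense but fails, and that `sₖ₊₄`, but
not `sₖ₊₃`, holds throughout `p₂` below some such point. -/
def presForm (k : ℕ) : PropForm :=
  let p := var 0
  let r := var 1
  let d := var 2
  conj
    [(p.and r).neg,
      d.imp (r.or r.neg),
      r.neg.imp d,
      (p.neg.and r.neg).neg.imp d,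
      (p.neg.neg.imp p).imp d,
      (d.imp (segForm (k + 3))).imp d,
      ((d.imp (segForm (k + 4))).imp d).imp d]

theorem presForm_vars_subset (k : ℕ) : (presForm k).vars ⊆ {0, 1, 2} := by
  refine vars_conj_subset (List.cons_ne_nil _ _) ?_
  simp only [List.forall_mem_cons, vars, segForm_vars, List.not_mem_nil, false_imp_iff,
    implies_true]
  decide

theorem mem_eval_presForm {α : Type} [Preorder α] {μ : ℕ → LowerSet α} {k : ℕ} {x : α} :
    x ∈ (presForm k).eval μ ↔
      (∀ y ≤ x, y ∈ μ 0 → y ∉ μ 1) ∧ (∀ y ≤ x, y ∈ μ 2 → y ∈ μ 1 ∨ ∀ z ≤ y, z ∉ μ 1) ∧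
      ∀ y ≤ x, y ∉ μ 2 →
        (∃ z ≤ y, z ∈ μ 1) ∧ (∃ z ≤ y, ∀ w ≤ z, w ∉ μ 0 ∧ w ∉ μ 1) ∧
        (∃ z ≤ y, z ∉ μ 0 ∧ ∀ w ≤ z, ∃ v ≤ w, v ∈ μ 0) ∧
        y ∉ ((var 2).imp (segForm (k + 3))).eval μ ∧
        ∃ z ≤ y, z ∈ ((var 2).imp (segForm (k + 4))).eval μ ∧ z ∉ μ 2 := by
  have contrapose : ∀ P : α → Prop,
      (∀ y ≤ x, P y → y ∈ μ 2) ↔ ∀ y ≤ x, y ∉ μ 2 → ¬ P y := fun P =>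
    forall₂_congr fun y _ => not_imp_not.symm
  simp only [presForm, mem_eval_conj, List.forall_mem_cons, List.not_mem_nil, false_imp_iff,
    implies_true, and_true, mem_eval_neg, mem_eval_and, mem_eval_var, mem_eval_or,
    mem_eval_imp (x := x)]
  simp only [contrapose, ← forall_and]
  simp only [mem_eval_neg, mem_eval_var, mem_eval_imp (B := var 2), mem_eval_imp (B := var 0),
    not_and, not_forall, not_not, exists_prop]
  grind

/-! ### Bounded morphisms into the frames -/

section Morphisms

open LadderFrame

variable {α : Type} [Preorder α] {μ : ℕ → LowerSet α} {x : α} {k n : ℕ}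

theorem isBoundedMorphism_principal {ν : ℕ → LowerSet α} {P : Finset ℕ}
    (h : ∀ y ≤ x, ∀ i ∈ P, y ∈ μ i ↔ y ∈ ν i) :
    IsBoundedMorphism P μ ν x Order.Ideal.principal where
  mem_iff y hy i hi := (h y hy i hi).trans principal_le_iff.symm
  mono _ _ _ hz := Order.Ideal.principal_le_iff.2 hz
  exists_principal _ _ b hb := ⟨b, hb, rfl⟩

theorem isBoundedMorphism_tip (k : ℕ) (h₀ : ∀ y ≤ x, y ∉ μ 0) (h₁ : x ∈ μ 1) (h₂ : x ∈ μ 2) :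
    IsBoundedMorphism {0, 1, 2} μ (stdVal k) x fun _ => Order.Ideal.principal tip where
  mem_iff y hy i hi := by
    rw [principal_le_iff]
    obtain rfl | rfl | rfl : i = 0 ∨ i = 1 ∨ i = 2 := by simpa using hi
    · exact iff_of_false (h₀ y hy) fun h => nomatch mem_stdVal_zero.1 h
    · exact iff_of_true ((μ 1).lower hy h₁) (mem_stdVal_one.2 rfl)
    · exact iff_of_true ((μ 2).lower hy h₂) (mem_stdVal_two.2 not_side_le_tip)
  mono _ _ _ _ := le_rfl
  exists_principal y _ b hb := ⟨y, le_rfl, by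
    obtain rfl : b = tip := mem_stdVal_one.1 hb
    rfl⟩

variable (μ x k) in
/-- The rungs that `x` sees. If `x` is not itself like a rung, then this is the whole ladder. -/
def ladderIdeal : Order.Ideal (LadderFrame k) where
  carrier := {b | ∃ n, b = rung n ∧ ∃ z ≤ x, IsLevel μ z n}
  lower' := by
    rintro _ b hb ⟨n, rfl, z, hz, hzn⟩
    cases b with
    | rung m =>
      obtain rfl | hmn := rung_le_rung_iff.1 hb
      · exact ⟨m, rfl, z, hz, hzn⟩
      · obtain ⟨w, hw, hwm⟩ := hzn.exists_of_add_two_le hmn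
        exact ⟨m, rfl, w, hw.trans hz, hwm⟩
    | tip => exact absurd hb not_tip_le_rung
    | side => exact absurd hb not_side_le_rung
    | root => exact absurd hb not_root_le_rung
  nonempty' := by
    obtain ⟨n, hn⟩ | h := exists_isLevel_or_forall_not_mem μ x
    · exact ⟨rung n, n, rfl, x, le_rfl, hn⟩
    · exact ⟨rung 0, 0, rfl, exists_isLevel_of_not_mem (h 2)⟩
  directed' := by
    rintro _ ⟨a, rfl, y, hy, hya⟩ _ ⟨b, rfl, z, hz, hzb⟩
    obtain ⟨n, hn⟩ | h := exists_isLevel_or_forall_not_mem μ x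
    · exact ⟨rung n, ⟨n, rfl, x, le_rfl, hn⟩, hn.eq_or_add_two_le hya hy,
        hn.eq_or_add_two_le hzb hz⟩
    · exact ⟨rung (a + b + 2), ⟨_, rfl, exists_isLevel_of_not_mem (h _)⟩,
        rung_le_rung_iff.2 (by lia), rung_le_rung_iff.2 (by lia)⟩

theorem IsLevel.ladderIdeal_eq (hx : IsLevel μ x n) :
    ladderIdeal μ x k = Order.Ideal.principal (rung n) := by
  refine le_antisymm ?_ (Order.Ideal.principal_le_iff.2 ⟨n, rfl, x, le_rfl, hx⟩)
  rintro _ ⟨m, rfl, z, hz, hzm⟩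
  exact hx.eq_or_add_two_le hzm hz

theorem ladderIdeal_le_iff_mem_zero :
    (ladderIdeal μ x k).toLowerSet ≤ stdVal k 0 ↔ x ∈ μ 0 := by
  constructor
  · intro h
    obtain ⟨n, hn⟩ | hx := exists_isLevel_or_forall_not_mem μ x
    · have hzero := mem_stdVal_zero.1 (h ⟨n, rfl, x, le_rfl, hn⟩)
      cases hzero
      exact hn.1
    · exact nomatch mem_stdVal_zero.1 (h ⟨1, rfl, exists_isLevel_of_not_mem (hx 3)⟩)
  · intro h
    have hx : IsLevel μ x 0 := ⟨h, not_mem_segForm_zero⟩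
    rw [hx.ladderIdeal_eq, principal_le_iff, mem_stdVal_zero]

theorem isBoundedMorphism_ladderIdeal (k : ℕ) (h₁ : ∀ y ≤ x, y ∉ μ 1) (h₂ : x ∈ μ 2) :
    IsBoundedMorphism {0, 1, 2} μ (stdVal k) x fun y => ladderIdeal μ y k where
  mem_iff y hy i hi := by
    obtain rfl | rfl | rfl : i = 0 ∨ i = 1 ∨ i = 2 := by simpa using hi
    · exact ladderIdeal_le_iff_mem_zero.symm
    · refine iff_of_false (h₁ y hy) fun h => ?_
      obtain ⟨b, n, rfl, hn⟩ := (ladderIdeal μ y k).nonempty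
      exact nomatch mem_stdVal_one.1 (h ⟨n, rfl, hn⟩)
    · refine iff_of_true ((μ 2).lower hy h₂) ?_
      rintro _ ⟨n, rfl, -⟩
      exact mem_stdVal_two.2 not_side_le_rung
  mono y _ z hz := by
    rintro _ ⟨n, rfl, w, hw, hwn⟩
    exact ⟨n, rfl, w, hw.trans hz, hwn⟩
  exists_principal y _ b hb := by
    obtain ⟨n, rfl, z, hz, hzn⟩ := hb
    exact ⟨z, hz, hzn.ladderIdeal_eq⟩

end Morphisms

/-! ### Rigidity of the frames -/

section Rigidity

open LadderFrame

variable {k m : ℕ} {μ : ℕ → LowerSet (LadderFrame m)} {x : LadderFrame m}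

theorem exists_three_isMin (hx : x ∈ (presForm k).eval μ) (hd : x ∉ μ 2) :
    ∃ p q r, (p ≤ x ∧ IsMin p ∧ p ∈ μ 0 ∧ p ∉ μ 1) ∧ (q ≤ x ∧ IsMin q ∧ q ∉ μ 0 ∧ q ∉ μ 1) ∧
      r ≤ x ∧ IsMin r ∧ r ∉ μ 0 ∧ r ∈ μ 1 := by
  obtain ⟨hdisj, -, hx⟩ := mem_eval_presForm.1 hx
  obtain ⟨⟨z₁, hz₁, hr⟩, ⟨z₂, hz₂, hq⟩, ⟨z₃, hz₃, -, hp⟩, -⟩ := hx x le_rfl hd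
  obtain ⟨r, hrz, hrmin⟩ := exists_isMin_le z₁
  obtain ⟨q, hqz, hqmin⟩ := exists_isMin_le z₂
  obtain ⟨p, hpz, hpmin⟩ := exists_isMin_le z₃
  obtain ⟨p', hpp', hp'⟩ := hp p hpz
  have hp₀ : p ∈ μ 0 := (μ 0).lower (hpmin hpp') hp'
  have hr₁ : r ∈ μ 1 := (μ 1).lower hrz hr
  have hpx := hpz.trans hz₃
  have hrx := hrz.trans hz₁
  exact ⟨p, q, r, ⟨hpx, hpmin, hp₀, hdisj p hpx hp₀⟩, ⟨hqz.trans hz₂, hqmin, hq q hqz⟩, hrx, hrmin,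
    fun hr₀ => hdisj r hrx hr₀ hr₁, hr₁⟩

theorem side_le_of_not_mem_two (hx : x ∈ (presForm k).eval μ) (hd : x ∉ μ 2) : side ≤ x := by
  obtain ⟨p, q, r, ⟨hpx, hp, hp₀, hp₁⟩, ⟨hqx, hq, hq₀, hq₁⟩, hrx, hr, hr₀, hr₁⟩ :=
    exists_three_isMin hx hd
  rw [isMin_iff] at hp hq hr
  have hmin : rung 0 ≤ x ∧ tip ≤ x := by grind
  exact side_le_of_rung_zero_of_tip hmin.1 hmin.2

theorem rung_three_mem_two (hx : x ∈ (presForm k).eval μ) (hd : x ∉ μ 2) : rung 3 ∈ μ 2 := by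
  have h3 : rung 3 ≤ x := le_trans (rung_le_side_iff.2 (by lia)) (side_le_of_not_mem_two hx hd)
  by_contra h
  exact not_side_le_rung (side_le_of_not_mem_two (LowerSet.lower _ h3 hx) h)

theorem mem_one_iff_eq_tip (hx : x ∈ (presForm k).eval μ) (hd : x ∉ μ 2) (y : LadderFrame m) :
    y ∈ μ 1 ↔ y = tip := by
  have h3 : rung 3 ≤ x := le_trans (rung_le_side_iff.2 (by lia)) (side_le_of_not_mem_two hx hd)
  have hdec := (mem_eval_presForm.1 hx).2.1 (rung 3) h3 (rung_three_mem_two hx hd)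
  have h03 : (rung 0 : LadderFrame m) ≤ rung 3 := rung_le_rung_iff.2 (by lia)
  have h13 : (rung 1 : LadderFrame m) ≤ rung 3 := rung_le_rung_iff.2 (by lia)
  have heq : rung 0 ∈ μ 1 ↔ rung 1 ∈ μ 1 := by
    obtain h | h := hdec
    · exact iff_of_true ((μ 1).lower h03 h) ((μ 1).lower h13 h)
    · exact iff_of_false (h _ h03) (h _ h13)
  obtain ⟨p, q, r, ⟨-, hp, hp₀, hp₁⟩, ⟨-, hq, hq₀, hq₁⟩, -, hr, -, hr₁⟩ :=
    exists_three_isMin hx hd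
  rw [isMin_iff] at hp hq hr
  obtain ⟨h0, h1, htip⟩ : rung 0 ∉ μ 1 ∧ rung 1 ∉ μ 1 ∧ tip ∈ μ 1 := by grind
  refine ⟨fun hy => ?_, fun hy => hy ▸ htip⟩
  by_contra hne
  obtain h | h := rung_zero_or_rung_one_le hne
  · exact h0 ((μ 1).lower h hy)
  · exact h1 ((μ 1).lower h hy)

theorem not_mem_two_iff_side_le (hx : x ∈ (presForm k).eval μ) (hd : x ∉ μ 2) {y : LadderFrame m}
    (hy : y ≤ x) : y ∉ μ 2 ↔ side ≤ y := by
  refine ⟨side_le_of_not_mem_two (LowerSet.lower _ hy hx), fun hsy hy₂ => ?_⟩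
  have h1 := mem_one_iff_eq_tip hx hd
  obtain h | h := (mem_eval_presForm.1 hx).2.1 y hy hy₂
  · obtain rfl := (h1 y).1 h
    exact not_side_le_tip hsy
  · exact h tip (tip_le_side.trans hsy) ((h1 tip).2 rfl)

theorem mem_zero_iff_eq_rung_zero (hx : x ∈ (presForm k).eval μ) (hd : x ∉ μ 2)
    (y : LadderFrame m) : y ∈ μ 0 ↔ y = rung 0 := by
  obtain ⟨p, q, r, ⟨-, hp, hp₀, hp₁⟩, ⟨-, hq, hq₀, hq₁⟩, -, -, hr₀, hr₁⟩ :=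
    exists_three_isMin hx hd
  obtain ⟨-, -, ⟨z, -, hz₀, hdense⟩, -⟩ := (mem_eval_presForm.1 hx).2.2 x le_rfl hd
  have mem_of_le : ∀ b ≤ z, IsMin b → b ∈ μ 0 := fun b hbz hb => by
    obtain ⟨v, hv, hv₀⟩ := hdense b hbz
    exact (μ 0).lower (hb hv) hv₀
  rw [mem_one_iff_eq_tip hx hd] at hp₁ hq₁ hr₁
  subst hr₁
  have hqz : ¬ q ≤ z := fun h => hq₀ (mem_of_le q h hq)
  have hrz : ¬ tip ≤ z := fun h => hr₀ (mem_of_le tip h (by simp [isMin_iff]))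
  rw [isMin_iff] at hp hq
  obtain rfl | rfl : q = rung 0 ∨ q = rung 1 := by tauto
  · obtain rfl := (eq_rung_one hqz hrz)
    exact absurd (mem_of_le _ le_rfl (by simp [isMin_iff])) hz₀
  · obtain rfl : p = rung 0 := by grind
    obtain rfl : z = rung 2 := (eq_rung_zero_or_two hqz hrz).resolve_left fun h => hz₀ (h ▸ hp₀)
    refine ⟨fun hy => ?_, fun hy => hy ▸ hp₀⟩
    by_contra hne
    obtain h | h | h := rung_one_or_rung_two_or_tip_le hne
    exacts [hq₀ ((μ 0).lower h hy), hz₀ ((μ 0).lower h hy), hr₀ ((μ 0).lower h hy)]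

theorem mem_iff_mem_stdVal (hx : x ∈ (presForm k).eval μ) (hd : x ∉ μ 2) :
    ∀ y ≤ x, ∀ i ∈ ({0, 1, 2} : Finset ℕ), y ∈ μ i ↔ y ∈ stdVal m i := by
  intro y hy i hi
  obtain rfl | rfl | rfl : i = 0 ∨ i = 1 ∨ i = 2 := by simpa using hi
  · rw [mem_stdVal_zero, mem_zero_iff_eq_rung_zero hx hd]
  · rw [mem_stdVal_one, mem_one_iff_eq_tip hx hd]
  · rw [mem_stdVal_two, ← not_mem_two_iff_side_le hx hd hy, not_not]

theorem index_eq_of_not_mem_two (hx : x ∈ (presForm k).eval μ) (hd : x ∉ μ 2) : k = m := by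
  have hsx := side_le_of_not_mem_two hx hd
  have hside : (side : LadderFrame m) ∉ μ 2 := (not_mem_two_iff_side_le hx hd hsx).2 le_rfl
  have eval_iff : ∀ n, ∀ z ≤ x, z ∈ ((var 2).imp (segForm n)).eval μ ↔
      z ∈ ((var 2).imp (segForm n)).eval (stdVal m) := fun n z hz => by
    rw [(isBoundedMorphism_principal (mem_iff_mem_stdVal hx hd)).mem_eval_iff _ hz,
      principal_le_iff]
    simp only [vars, segForm_vars]
    decide
  obtain ⟨-, -, -, hk, z, hz, hkz, hdz⟩ := (mem_eval_presForm.1 hx).2.2 side hsx hside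
  rw [eval_iff _ _ hsx, side_mem_imp_segForm_iff] at hk
  have hzs : side ≤ z := (not_mem_two_iff_side_le hx hd (hz.trans hsx)).1 hdz
  obtain rfl := le_antisymm hz hzs
  rw [eval_iff _ _ hsx, side_mem_imp_segForm_iff] at hkz
  lia

theorem exists_isBoundedMorphism (hx : x ∈ (presForm k).eval μ) :
    ∃ τ, IsBoundedMorphism {0, 1, 2} μ (stdVal k) x τ := by
  by_cases hd : x ∈ μ 2
  · obtain ⟨hdisj, hdec, -⟩ := mem_eval_presForm.1 hx
    obtain hr | hr := hdec x le_rfl hd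
    · exact ⟨_, isBoundedMorphism_tip k (fun y hy hp => hdisj y hy hp ((μ 1).lower hy hr)) hr hd⟩
    · exact ⟨_, isBoundedMorphism_ladderIdeal k hr hd⟩
  · obtain rfl := index_eq_of_not_mem_two hx hd
    exact ⟨_, isBoundedMorphism_principal (mem_iff_mem_stdVal hx hd)⟩

end Rigidity

/-! ### The algebras of lower sets -/

/-- A formula in the standard valuation of the `k`-th frame cutting out all points but the
greatest one. -/
def opForm (k : ℕ) : PropForm := (var 2).or ((var 2).imp (segForm (k + 4)))

theorem opForm_vars_subset (k : ℕ) : (opForm k).vars ⊆ {0, 1, 2} := by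
  simp only [opForm, vars, segForm_vars]
  decide

section Generation

open LadderFrame

variable {k : ℕ}

theorem eq_sup_of_finite_diff {α : Type*} [Preorder α] {L U : LowerSet α} (hLU : L ≤ U)
    (hfin : ((U : Set α) \ L).Finite) : U = L ⊔ hfin.toFinset.sup LowerSet.Iic := by
  refine le_antisymm (fun x hx => ?_)
    (sup_le hLU (Finset.sup_le fun x hx => LowerSet.Iic_le.2 (hfin.mem_toFinset.1 hx).1))
  by_cases hxL : x ∈ L
  · exact .inl hxL
  · exact .inr (Finset.le_sup (f := LowerSet.Iic) (hfin.mem_toFinset.2 ⟨hx, hxL⟩) le_rfl)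

theorem finite_of_forall_rung_mem_lt {s : Set (LadderFrame k)} {N : ℕ}
    (h : ∀ n, rung n ∈ s → n < N) : s.Finite := by
  refine (((Set.finite_Iio N).image rung).union (Set.toFinite {tip, side, root})).subset ?_
  intro x hx
  cases x with
  | rung n => exact .inl ⟨n, h n hx, rfl⟩
  | tip | side | root => simp

/-- A formula whose value in the standard valuation is the ladder. -/
def ladderForm : PropForm := (var 2).and (var 1).neg

theorem mem_eval_ladderForm {x : LadderFrame k} :
    x ∈ ladderForm.eval (stdVal k) ↔ ∃ n, x = rung n := by
  simp only [ladderForm, mem_eval_and, mem_eval_neg, mem_eval_var, mem_stdVal_two, mem_stdVal_one,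
    LadderFrame.forall_iff]
  cases x <;> simp

/-- A formula whose value in the standard valuation is the principal lower set of a point. -/
def pointForm : LadderFrame k → PropForm
  | rung 0 => var 0
  | rung (n + 1) => ladderForm.and ((segForm (n + 1)).imp (segForm n))
  | tip => var 1
  | side => (var 2).imp (segForm (k + 4))
  | root => (var 0).imp (var 0)

theorem pointForm_vars_subset (x : LadderFrame k) : (pointForm x).vars ⊆ {0, 1, 2} := by
  rcases x with (_ | n) | _ | _ | _ <;> simp only [pointForm, ladderForm, vars, segForm_vars] <;>
    decide

theorem eval_pointForm (x : LadderFrame k) : (pointForm x).eval (stdVal k) = LowerSet.Iic x := by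
  ext y
  simp only [SetLike.mem_coe, LowerSet.mem_Iic_iff]
  rcases x with (_ | n) | _ | _ | _
  · simp only [pointForm, mem_eval_var, mem_stdVal_zero]
    cases y <;> simp
  · simp only [pointForm, mem_eval_and, mem_eval_ladderForm]
    cases y with
    | rung m => simp [rung_mem_imp_segForm_iff]
    | tip | side | root => simp
  · rfl
  · rw [pointForm]
    cases y with
    | rung m =>
      rw [rung_mem_var_two_imp_segForm_iff, rung_le_side_iff]
    | tip => simp [mem_eval_imp, LadderFrame.forall_iff, tip_mem_segForm]
    | side => simp only [side_mem_imp_segForm_iff, le_refl]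
    | root => simp [root_not_mem_imp_segForm]
  · simp [pointForm, mem_eval_imp]

theorem generates_stdVal (k : ℕ) :
    Generates (stdVal k '' (({0, 1, 2} : Finset ℕ) : Set ℕ)) := by
  let Definable (U : LowerSet (LadderFrame k)) : Prop :=
    ∃ A : PropForm, A.vars ⊆ {0, 1, 2} ∧ A.eval (stdVal k) = U
  have sup_definable (U : LowerSet (LadderFrame k)) (hU : Definable U)
      (W : LowerSet (LadderFrame k)) (hW : Definable W) : Definable (U ⊔ W) := by
    obtain ⟨A, hA, rfl⟩ := hU
    obtain ⟨B, hB, rfl⟩ := hW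
    exact ⟨A.or B, Finset.union_subset hA hB, rfl⟩
  have bot_definable : Definable ⊥ := ⟨(var 0).and (var 0).neg, by decide, inf_compl_self _⟩
  have of_finite_diff {L U : LowerSet (LadderFrame k)} (hL : Definable L) (hLU : L ≤ U)
      (hfin : ((U : Set (LadderFrame k)) \ L).Finite) : Definable U := by
    rw [eq_sup_of_finite_diff hLU hfin]
    exact sup_definable _ hL _ <| Finset.sup_induction bot_definable sup_definable fun x _ =>
      ⟨pointForm x, pointForm_vars_subset x, eval_pointForm x⟩
  refine generates_iff.2 fun U => ?_
  by_cases hU : ∀ n, rung n ∈ U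
  · refine of_finite_diff ⟨ladderForm, by decide, rfl⟩ (fun x hx => ?_)
      (finite_of_forall_rung_mem_lt (N := 0) fun n hn => ?_)
    · obtain ⟨n, rfl⟩ := mem_eval_ladderForm.1 hx
      exact hU n
    · exact absurd (mem_eval_ladderForm.2 ⟨n, rfl⟩) hn.2
  · push Not at hU
    obtain ⟨N, hN⟩ := hU
    refine of_finite_diff bot_definable bot_le
      (finite_of_forall_rung_mem_lt (N := N + 2) fun n hn => ?_)
    by_contra h
    exact hN (U.lower (rung_le_rung_iff.2 (by lia)) hn.1)

end Generation

/-! ### The variety -/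

section FrameAlgebra

open LadderFrame

theorem isOpremum_opForm (k : ℕ) : IsOpremum ((opForm k).eval (stdVal k)) := by
  have mem_opForm_iff : ∀ x : LadderFrame k, x ∈ (opForm k).eval (stdVal k) ↔ x ≠ root := by
    simp [LadderFrame.forall_iff, opForm, mem_eval_or, mem_eval_var, mem_stdVal_two,
      side_mem_imp_segForm_iff, root_not_mem_imp_segForm]
  constructor
  · intro h
    exact (mem_opForm_iff root).1 (h ▸ trivial) rfl
  · intro U hU x hx
    refine (mem_opForm_iff x).2 ?_
    rintro rfl
    exact hU (eq_top_iff.2 fun y _ => U.lower (le_root y) hx)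

theorem eval_presForm_stdVal (k : ℕ) : (presForm k).eval (stdVal k) = ⊤ := by
  suffices root ∈ (presForm k).eval (stdVal k) from
    eq_top_iff.2 fun y _ => LowerSet.lower _ (le_root y) this
  refine mem_eval_presForm.2 ⟨fun y _ h₀ h₁ => ?_, fun y _ h₂ => ?_, fun y _ h₂ => ?_⟩
  · exact nomatch (mem_stdVal_zero.1 h₀).symm.trans (mem_stdVal_one.1 h₁)
  · cases y with
    | rung n =>
      exact .inr fun z hz hz₁ => not_tip_le_rung (mem_stdVal_one.1 hz₁ ▸ hz)
    | tip => exact .inl (mem_stdVal_one.2 rfl)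
    | side => exact absurd le_rfl (mem_stdVal_two.1 h₂)
    | root => exact absurd (le_root side) (mem_stdVal_two.1 h₂)
  · have of_le_side : ∀ z ≤ side, z ≤ y := fun z hz => hz.trans (not_not.1 h₂)
    refine ⟨⟨tip, of_le_side _ tip_le_side, mem_stdVal_one.2 rfl⟩,
      ⟨rung 1, of_le_side _ (rung_le_side_iff.2 (by lia)), fun w hw => ?_⟩,
      ⟨rung 2, of_le_side _ (rung_le_side_iff.2 (by lia)), ?_, fun w hw => ?_⟩,
      fun h => ?_, side, of_le_side _ le_rfl, side_mem_imp_segForm_iff.2 le_rfl, ?_⟩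
    · rw [mem_stdVal_zero, mem_stdVal_one]
      cases w <;> grind
    · simp [mem_stdVal_zero]
    · refine ⟨rung 0, ?_, mem_stdVal_zero.2 rfl⟩
      cases w <;> grind
    · have := side_mem_imp_segForm_iff.1 (LowerSet.lower _ (of_le_side _ le_rfl) h)
      lia
    · exact fun h => mem_stdVal_two.1 h le_rfl

/-- The Heyting algebra of lower sets of the `k`-th frame. -/
abbrev frameAlg (k : ℕ) : HeytAlg.{0} := HeytAlg.of (LowerSet (LadderFrame k))

/-- The variety generated by the algebras of all frames. -/
def frameVariety : Set HeytAlg.{0} := Mod {A | ∀ k, Valid (frameAlg k) A}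

theorem isVariety_frameVariety : IsVariety frameVariety := ⟨_, rfl⟩

theorem frameAlg_mem (k : ℕ) : frameAlg k ∈ frameVariety := fun _ hA => hA k

theorem defines_presForm (k : ℕ) :
    Defines frameVariety {0, 1, 2} (presForm k) (frameAlg k) (stdVal k) where
  vars_subset := presForm_vars_subset k
  generates := generates_stdVal k
  eval_eq := eval_presForm_stdVal k
  valid_imp B hB hBν K hK := by
    refine hK _ fun m μ => himp_eq_top_iff.2 fun x hx => ?_
    obtain ⟨τ, hτ⟩ := exists_isBoundedMorphism hx
    exact (hτ.mem_eval_iff hB le_rfl).2 (hBν ▸ le_top)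

theorem isCharFormula_frameAlg (k : ℕ) :
    IsCharFormula frameVariety (frameAlg k) ((presForm k).imp (opForm k)) :=
  ⟨frameAlg_mem k, (isOpremum_opForm k).subdirectlyIrreducible, _, _, _, _, defines_presForm k,
    opForm_vars_subset k, isOpremum_opForm k, rfl⟩

theorem infinite_frameAlg (k : ℕ) : Infinite (frameAlg k) :=
  Infinite.of_injective (fun n => LowerSet.Iic (rung n : LadderFrame k)) fun m n h => by
    simpa using h

theorem pairwise_not_inSH_frameAlg : Pairwise fun k m => ¬ InSH (frameAlg k) (frameAlg m) := by
  intro k m hkm h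
  refine (isCharFormula_frameAlg k).not_valid (h.valid fun μ => ?_)
  refine himp_eq_top_iff.2 fun x hx => ?_
  by_contra hxo
  exact hkm (index_eq_of_not_mem_two hx fun hd => hxo (.inl hd))

end FrameAlgebra

end CharForm

theorem theorem6p5 :
    Cardinal.mk {W : Set HeytAlg.{0} // CharForm.IsVariety W ∧
        CharForm.AxiomatizedByCharFormulas W ∧ ¬ CharForm.AxiomatizedByJankovFormulas W} =
      Cardinal.continuum ∧
    ∃ V : Set HeytAlg.{0}, CharForm.IsVariety V ∧
      ∃ H : ℕ → HeytAlg.{0},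
        (∀ k, H k ∈ CharForm.FPSI V ∧ Infinite (H k)) ∧
        (∀ k m, k ≠ m → ¬ CharForm.InSH (H k) (H m)) ∧
        ∀ χ : ℕ → CharForm.PropForm, (∀ k, CharForm.IsCharFormula V (H k) (χ k)) →
          CharForm.Independent V (Set.range χ) ∧
          Function.Injective (fun S : Set ℕ => CharForm.Mod (χ '' S)) ∧
          ∀ S : Set ℕ, S.Nonempty →
            ¬ CharForm.AxiomatizedByJankovFormulas (CharForm.Mod (χ '' S)) := by
  open CharForm in
  have hV := isVariety_frameVariety
  have hSH := pairwise_not_inSH_frameAlg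
  refine ⟨mk_axiomatizedByCharFormulas hV infinite_frameAlg hSH isCharFormula_frameAlg,
    frameVariety, hV, frameAlg, fun k => ⟨⟨frameAlg_mem k, ?_, ?_⟩, infinite_frameAlg k⟩,
    fun k m hkm => hSH hkm, fun χ hχ => ⟨independent_range hSH hχ, mod_image_injective hSH hχ,
      fun S hS => not_axiomatizedByJankovFormulas_image hV infinite_frameAlg hχ hS⟩⟩
  · exact (isOpremum_opForm k).subdirectlyIrreducible
  · exact ⟨_, _, _, defines_presForm k⟩
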